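/- Let $\nu$ be a valuation of the quotient field of a local domain $(R,\mathfrak m_R)$ with value group $\mathbb Z$ (a discrete valuation of rank $1$). We say that $\nu$ dominates $R$ if $\nu(f)\ge 0$ for all $f\in R$ and $\mathfrak m_R=\{f\in R \mid \nu(f)>0\}$, and we put $I_n=\{f\in R\mid \nu(f)\ge n\}$ for $n\in\mathbb N$. A quasi-polynomial is a function of the form $Q(n)=a_d(n)n^d+\dots+a_1(n)n+a_0(n)$ on $\mathbb N$, where each $a_i:\mathbb N\to\mathbb R$ is periodic with a positive integral period. Theorem. There exist a regular local ring $(R,\mathfrak m_R)$ of dimension $2$ and a discrete valuation $\nu$ of rank $1$ of the quotient field of $R$, dominating $R$, such that all the lengths $\ell_R(I_n/I_{n+1})$ and $\ell_R(R/I_n)$ are finite, and such that neither of the functions $n\mapsto\ell_R(I_n/I_{n+1})$ and $n\mapsto\ell_R(R/I_n)$ can be written as a quasi-polynomial plus a bounded function for large $n$. In particular, the Hilbert function $\ell_R(R/I_n)$ cannot be so written. -/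

import Mathlib

section ValuationIdeals

variable {R K : Type*} [CommRing R] [IsLocalRing R] [Field K] [Algebra R K]

/-- The valuation `ν` of `K`, written additively, is discrete with value group exactly `ℤ`
(so it has rank one and is normalized). -/
def IsNormalizedDiscrete (ν : AddValuation K (WithTop ℤ)) : Prop :=
  Function.Surjective ν

variable (R) in
/-- `ν` dominates the local ring `R`: the valuation ring of `ν` contains `R`, and its maximal ideal
`{f | 0 < ν f}` contracts to the maximal ideal of `R`. -/
structure Dominates (ν : AddValuation K (WithTop ℤ)) : Prop where
  nonneg : ∀ f : R, 0 ≤ ν (algebraMap R K f)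
  mem_maximalIdeal_iff : ∀ f : R, f ∈ IsLocalRing.maximalIdeal R ↔ 0 < ν (algebraMap R K f)

/-- The valuation ideal `I_n = {f ∈ R | ν f ≥ n}`. -/
def valuationIdeal (ν : AddValuation K (WithTop ℤ)) (h : Dominates R ν) (n : ℕ) : Ideal R where
  carrier := {f | ((n : ℤ) : WithTop ℤ) ≤ ν (algebraMap R K f)}
  zero_mem' := by simp
  add_mem' := by
    intro a b ha hb
    simp only [Set.mem_ofPred_eq, map_add] at *
    exact ν.map_le_add ha hb
  smul_mem' := by
    intro c f hf
    simp only [Set.mem_ofPred_eq, smul_eq_mul, map_mul, AddValuation.map_mul] at *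
    exact le_add_of_nonneg_of_le (h.nonneg c) hf

end ValuationIdeals

/-- `Q` is a quasi-polynomial: `Q n = a_d(n) n^d + ⋯ + a_1(n) n + a_0(n)`, where each coefficient
`a_i` is a periodic function of the integer `n`. -/
def IsQuasiPolynomial (Q : ℕ → ℝ) : Prop :=
  ∃ (d : ℕ) (a : ℕ → ℕ → ℝ),
    (∀ i ≤ d, ∃ s : ℕ, 0 < s ∧ Function.Periodic (a i) s) ∧
    ∀ n : ℕ, Q n = ∑ i ∈ Finset.range (d + 1), a i n * (n : ℝ) ^ i

/-- For all large `n`, the function `f` is the sum of a quasi-polynomial and a bounded function. -/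
def IsEventuallyQuasiPolynomialPlusBounded (f : ℕ → ℝ) : Prop :=
  ∃ Q σ : ℕ → ℝ, IsQuasiPolynomial Q ∧ (∃ M : ℝ, ∀ n, |σ n| ≤ M) ∧
    ∃ N : ℕ, ∀ n ≥ N, f n = Q n + σ n

/-!
The ring is the local ring `R` of the affine plane over `k = 𝔽₂(s₀, s₁, …)` at the origin, and the
valuation is the order of vanishing along a formal branch `t ↦ (t, y(t))`, where
`y = ∑ i, c i * t ^ e i` has coefficients `c i = s i ^ (1 / 2 ^ (i + 1))` in an algebraic closure
`L` of `k`. Since the residue field of `R` is `k`, the length of `I_n / I_{n+1}` is the `k`-dimension of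
the space `V_n` of coefficients of order `n` of the elements of `I_n`
(`length_valuationIdeal_quotient_succ`), and the length of `R / I_n` is the sum of the dimensions of
the `V_m` with `m < n`.

These dimensions tend to infinity, but slowly.

* They tend to infinity because the residue field of the valuation has infinite degree over
  `k`. By
  additivity of Frobenius, `y ^ 2 ^ j` minus a suitable polynomial in `t` over `k` has initial
  coefficient `c j ^ 2 ^ j = √(s j)` (`exists_lacunarySeries_pow_sub`), and these square roots are
  linearly independent over `k` (`linearIndependent_of_sq_eq_X`). As `t` has order one, each of them
  belongs to `V_n` for all large `n`. The same elements show that `y` is transcendental over `k[t]`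
  (`transcendental_of_infinite_residue`), so that `R` embeds into `L⟦t⟧` and the order is a
  valuation of its fraction field.
* They are `o(n)` because for `n < e j` only `c i` with `i < j` can occur, so `V_n` lies in the
  finite extension `k(c i | i < j)`, and the exponents are chosen large compared with the degrees of these
  extensions (`finrank_branchSpace_isLittleO`).

So the length of `I_n / I_{n+1}` is unbounded and `o(n)`, and the length of `R / I_n` grows faster
than `n` and is `o(n ^ 2)`. A quasi-polynomial plus a bounded function cannot grow strictly between
two consecutive powers of `n` (`not_isEventuallyQuasiPolynomialPlusBounded_of_isLittleO`).
-/

/-! ### Growth of quasi-polynomials -/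

section Growth

open Filter Asymptotics

/-- A function growing strictly faster than `n ^ d` and strictly slower than `n ^ (d + 1)` is not a
quasi-polynomial up to a bounded error: along the multiples of a common period of the coefficients,
a quasi-polynomial is an honest polynomial, whose degree would have to lie strictly between `d` and
`d + 1`. -/
theorem not_isEventuallyQuasiPolynomialPlusBounded_of_isLittleO {f : ℕ → ℝ} (d : ℕ)
    (hlow : (fun n : ℕ => (n : ℝ) ^ d) =o[atTop] f)
    (hupp : f =o[atTop] fun n : ℕ => (n : ℝ) ^ (d + 1)) :
    ¬ IsEventuallyQuasiPolynomialPlusBounded f := by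
  rintro ⟨Q, σ, ⟨D, a, hper, hQ⟩, ⟨M, hM⟩, N, hN⟩
  choose! s hs0 hs using hper
  -- The product `S` of the periods is a common period; `P` is the restriction of `Q` to its
  -- multiples.
  set S := ∏ i ∈ Finset.range (D + 1), s i with hS
  have hSpos : 0 < S := Finset.prod_pos fun i hi =>
    hs0 i (Nat.lt_succ_iff.mp (Finset.mem_range.mp hi))
  set P : Polynomial ℝ :=
    ∑ i ∈ Finset.range (D + 1), Polynomial.C (a i 0 * (S : ℝ) ^ i) * Polynomial.X ^ i with hP
  have hQP : ∀ m : ℕ, Q (S * m) = P.eval (m : ℝ) := by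
    intro m
    rw [hQ, hP, Polynomial.eval_finsetSum]
    refine Finset.sum_congr rfl fun i hi => ?_
    obtain ⟨r, hr⟩ : s i ∣ S := Finset.dvd_prod_of_mem s hi
    have hai : a i (S * m) = a i 0 := by
      have := ((hs i (Nat.lt_succ_iff.mp (Finset.mem_range.mp hi))).nat_mul (r * m)) 0
      rw [← this, hr]
      congr 1
      push_cast
      ring
    rw [hai]
    simp only [Polynomial.eval_mul, Polynomial.eval_C, Polynomial.eval_pow, Polynomial.eval_X]
    push_cast
    ring
  have htend : Tendsto (fun m : ℕ => S * m) atTop atTop :=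
    tendsto_id.const_mul_atTop' hSpos
  have hcast : Tendsto (fun m : ℕ => (m : ℝ)) atTop atTop := tendsto_natCast_atTop_atTop
  have hfP : (fun m : ℕ => f (S * m)) =ᶠ[atTop] fun m => P.eval (m : ℝ) + σ (S * m) := by
    filter_upwards [htend.eventually_ge_atTop N] with m hm
    rw [hN _ hm, hQP]
  have hσ : (fun m : ℕ => σ (S * m)) =O[atTop] fun _ => (1 : ℝ) :=
    IsBigO.of_bound M (Eventually.of_forall fun m => by simpa using hM (S * m))
  have hscale : ∀ e : ℕ, (fun m : ℕ => ((S * m : ℕ) : ℝ) ^ e) =O[atTop]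
      fun m : ℕ => (m : ℝ) ^ e := by
    intro e
    simp only [Nat.cast_mul, mul_pow]
    exact isBigO_const_mul_self _ _ _
  have hscale' : ∀ e : ℕ, (fun m : ℕ => (m : ℝ) ^ e) =O[atTop]
      fun m : ℕ => ((S * m : ℕ) : ℝ) ^ e := by
    intro e
    simp only [Nat.cast_mul, mul_pow]
    exact isBigO_self_const_mul (pow_ne_zero _ (by exact_mod_cast hSpos.ne')) _ _
  have hone : ∀ e : ℕ, (fun _ : ℕ => (1 : ℝ)) =O[atTop] fun m : ℕ => (m : ℝ) ^ e := by
    intro e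
    refine IsBigO.of_bound 1 ?_
    filter_upwards [eventually_ge_atTop 1] with m hm
    have : (1 : ℝ) ≤ (m : ℝ) ^ e := one_le_pow₀ (by exact_mod_cast hm)
    rw [one_mul, norm_one, Real.norm_of_nonneg (by positivity)]
    exact this
  have hirr : ∀ e : ℕ, ¬ (fun m : ℕ => (m : ℝ) ^ e) =o[atTop] fun m : ℕ => (m : ℝ) ^ e := by
    intro e h
    refine h.not_isBigO ?_ (isBigO_refl _ _)
    exact (eventually_ge_atTop 1).frequently.mono fun m hm =>
      pow_ne_zero _ (by exact_mod_cast (show m ≠ 0 by omega))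
  have hfup : (fun m : ℕ => f (S * m)) =o[atTop] fun m : ℕ => (m : ℝ) ^ (d + 1) :=
    (hupp.comp_tendsto htend).trans_isBigO (hscale _)
  have hσup : (fun m : ℕ => σ (S * m)) =o[atTop] fun m : ℕ => (m : ℝ) ^ (d + 1) := by
    refine hσ.trans_isLittleO ?_
    have : Tendsto (fun m : ℕ => (m : ℝ) ^ (d + 1)) atTop atTop :=
      (tendsto_pow_atTop d.succ_ne_zero).comp hcast
    exact (isLittleO_const_left.mpr (Or.inr (tendsto_norm_atTop_atTop.comp this)))
  have hPup : (fun m : ℕ => P.eval (m : ℝ)) =o[atTop] fun m : ℕ => (m : ℝ) ^ (d + 1) := by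
    refine (hfup.sub hσup).congr' ?_ EventuallyEq.rfl
    filter_upwards [hfP] with m hm
    rw [hm, add_sub_cancel_right]
  have hdeg : P.degree ≤ d := by
    by_contra hlt
    have hle : (Polynomial.X ^ (d + 1) : Polynomial ℝ).degree ≤ P.degree := by
      rw [Polynomial.degree_X_pow]
      push Not at hlt
      exact Nat.WithBot.add_one_le_of_lt hlt
    have := (Polynomial.isBigO_atTop_of_degree_le _ _ hle).comp_tendsto hcast
    simp only [Function.comp_def, Polynomial.eval_pow, Polynomial.eval_X] at this
    exact hirr _ (this.trans_isLittleO hPup)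
  have hPO : (fun m : ℕ => P.eval (m : ℝ)) =O[atTop] fun m : ℕ => (m : ℝ) ^ d := by
    have hle : P.degree ≤ (Polynomial.X ^ d : Polynomial ℝ).degree := by
      rwa [Polynomial.degree_X_pow]
    have := (Polynomial.isBigO_atTop_of_degree_le _ _ hle).comp_tendsto hcast
    simpa only [Function.comp_def, Polynomial.eval_pow, Polynomial.eval_X] using this
  have hfO : (fun m : ℕ => f (S * m)) =O[atTop] fun m : ℕ => (m : ℝ) ^ d :=
    (hPO.add (hσ.trans (hone d))).congr' hfP.symm EventuallyEq.rfl
  exact hirr d (((hscale' d).trans_isLittleO (hlow.comp_tendsto htend)).trans_isBigO hfO)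

theorem isLittleO_sum_range_of_tendsto {α : ℕ → ℕ} (h : Tendsto α atTop atTop) :
    (fun n : ℕ => (n : ℝ)) =o[atTop] fun n => ((∑ m ∈ Finset.range n, α m : ℕ) : ℝ) := by
  rw [isLittleO_iff_nat_mul_le]
  intro N
  obtain ⟨n₀, hn₀⟩ := eventually_atTop.mp (h.eventually_ge_atTop (2 * N))
  filter_upwards [eventually_ge_atTop (2 * n₀)] with n hn
  simp only [Real.norm_natCast]
  norm_cast
  calc N * n ≤ 2 * N * (n - n₀) := by
        obtain ⟨r, rfl⟩ := Nat.exists_eq_add_of_le hn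
        rw [show 2 * n₀ + r - n₀ = n₀ + r by omega]
        nlinarith [Nat.zero_le (N * r)]
    _ = ∑ m ∈ Finset.Ico n₀ n, 2 * N := by simp [mul_comm]
    _ ≤ ∑ m ∈ Finset.Ico n₀ n, α m :=
        Finset.sum_le_sum fun m hm => hn₀ m (Finset.mem_Ico.mp hm).1
    _ ≤ ∑ m ∈ Finset.range n, α m := by
        refine Finset.sum_le_sum_of_subset fun m hm => ?_
        exact Finset.mem_range.mpr (Finset.mem_Ico.mp hm).2

theorem sum_range_isLittleO_of_isLittleO {α : ℕ → ℕ}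
    (h : (fun n => (α n : ℝ)) =o[atTop] fun n : ℕ => (n : ℝ)) :
    (fun n => ((∑ m ∈ Finset.range n, α m : ℕ) : ℝ)) =o[atTop] fun n : ℕ => (n : ℝ) ^ 2 := by
  have hsum : Tendsto (fun n => ∑ m ∈ Finset.range n, (m : ℝ)) atTop atTop := by
    have : ∀ n : ℕ, (n : ℝ) - 1 ≤ ∑ m ∈ Finset.range n, (m : ℝ) := by
      intro n
      induction n with
      | zero => simp
      | succ n ih =>
        rw [Finset.sum_range_succ]
        rcases n with _ | n
        · simp
        · push_cast at ih ⊢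
          have := Nat.cast_nonneg (α := ℝ) n
          linarith
    refine tendsto_atTop_mono this ?_
    exact tendsto_atTop_add_const_right _ _ tendsto_natCast_atTop_atTop
  have := h.sum_range (fun n => Nat.cast_nonneg n) hsum
  push_cast
  refine this.trans_isBigO (IsBigO.of_bound 1 (Eventually.of_forall fun n => ?_))
  rw [Real.norm_of_nonneg (Finset.sum_nonneg fun _ _ => Nat.cast_nonneg _), one_mul,
    Real.norm_of_nonneg (by positivity)]
  calc ∑ m ∈ Finset.range n, (m : ℝ) ≤ ∑ m ∈ Finset.range n, (n : ℝ) :=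
        Finset.sum_le_sum fun m hm => by exact_mod_cast (Finset.mem_range.mp hm).le
    _ = (n : ℝ) ^ 2 := by simp [sq]

end Growth

/-! ### The valuation of an embedding into power series, and its lengths -/

theorem length_quotient_eq_add_of_le {R M : Type*} [CommRing R] [AddCommGroup M] [Module R M]
    {P N : Submodule R M} (h : P ≤ N) :
    Module.length R (M ⧸ P) = Module.length R (N ⧸ P.submoduleOf N) + Module.length R (M ⧸ N) := by
  refine Module.length_eq_add_of_exact (Submodule.mapQ (P.submoduleOf N) P N.subtype le_rfl)
    (Submodule.factor h) ?_ (Submodule.factor_surjective h) ?_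
  · rw [← LinearMap.ker_eq_bot]
    exact Submodule.ker_liftQ_eq_bot' _ _ (by rw [LinearMap.ker_comp, Submodule.ker_mkQ]; rfl)
  · intro q
    obtain ⟨m, rfl⟩ := Submodule.Quotient.mk_surjective P q
    constructor
    · intro hm
      have hmN : m ∈ N := (Submodule.Quotient.mk_eq_zero N).mp hm
      exact ⟨Submodule.Quotient.mk ⟨m, hmN⟩, rfl⟩
    · rintro ⟨z, hz⟩
      obtain ⟨z, rfl⟩ := Submodule.Quotient.mk_surjective _ z
      rw [← hz]
      exact (Submodule.Quotient.mk_eq_zero N).mpr z.2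

section SeriesValuation

open PowerSeries

/-- The `k`-space of initial coefficients of order `n`: the coefficients of `X ^ n` in the series
`Φ r` divisible by `X ^ n`. Surjectivity of `ρ`, through which `R` acts on constant coefficients,
makes it stable under `k`. -/
def initialCoeffSpace {R L k : Type*} [CommRing R] [Field L] [Field k] [Algebra k L]
    (Φ : R →+* L⟦X⟧) {ρ : R →+* k} (hρ : Function.Surjective ρ)
    (hΦρ : ∀ r, constantCoeff (Φ r) = algebraMap k L (ρ r)) (n : ℕ) : Submodule k L where
  carrier := {c | ∃ r, X ^ n ∣ Φ r ∧ coeff n (Φ r) = c}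
  zero_mem' := ⟨0, by simp⟩
  add_mem' := by
    rintro _ _ ⟨r, hr, rfl⟩ ⟨s, hs, rfl⟩
    exact ⟨r + s, by rw [map_add]; exact dvd_add hr hs, by simp⟩
  smul_mem' := by
    rintro a _ ⟨r, ⟨g, hg⟩, rfl⟩
    obtain ⟨b, rfl⟩ := hρ a
    refine ⟨b * r, by rw [map_mul, hg]; exact (dvd_mul_right _ _).mul_left _, ?_⟩
    rw [map_mul, hg, mul_left_comm, coeff_X_pow_mul', coeff_X_pow_mul']
    simp [hΦρ, Algebra.smul_def]

theorem injective_ofPowerSeries_comp {R L : Type*} [CommRing R] [Field L] {Φ : R →+* L⟦X⟧}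
    (hΦ : Function.Injective Φ) :
    Function.Injective ((HahnSeries.ofPowerSeries ℤ L).comp Φ) :=
  HahnSeries.ofPowerSeries_injective.comp hΦ

variable {R L : Type*} [CommRing R] [IsDomain R] [Field L]

/-- The valuation of the fraction field of `R` induced by an embedding `Φ : R → L⟦X⟧`: the order
in `X` of the Laurent series attached to a fraction. -/
noncomputable def seriesValuation (Φ : R →+* L⟦X⟧) (hΦ : Function.Injective Φ) :
    AddValuation (FractionRing R) (WithTop ℤ) :=
  (HahnSeries.addVal ℤ L).comap (IsFractionRing.lift (injective_ofPowerSeries_comp hΦ))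

variable {Φ : R →+* L⟦X⟧} (hΦ : Function.Injective Φ)

theorem seriesValuation_algebraMap (r : R) :
    seriesValuation Φ hΦ (algebraMap R (FractionRing R) r) =
      (HahnSeries.ofPowerSeries ℤ L (Φ r)).orderTop := by
  change HahnSeries.addVal ℤ L (IsFractionRing.lift (injective_ofPowerSeries_comp hΦ) _) = _
  rw [IsFractionRing.lift_algebraMap, HahnSeries.addVal_apply]
  rfl

theorem le_seriesValuation_algebraMap_iff (n : ℕ) (r : R) :
    ((n : ℤ) : WithTop ℤ) ≤ seriesValuation Φ hΦ (algebraMap R (FractionRing R) r) ↔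
      X ^ n ∣ Φ r := by
  rw [seriesValuation_algebraMap, HahnSeries.le_orderTop_iff_forall, X_pow_dvd_iff]
  constructor
  · intro h m hm
    rw [← HahnSeries.ofPowerSeries_apply_coeff (Γ := ℤ)]
    exact h m (by exact_mod_cast hm)
  · intro h j hj
    rw [PowerSeries.coeff_coe]
    split_ifs with h0
    · rfl
    · have : j < n := by exact_mod_cast hj
      exact h _ (by omega)

theorem seriesValuation_surjective {x : R} (hx : Φ x = X) :
    Function.Surjective (seriesValuation Φ hΦ) := by
  intro m
  induction m using WithTop.recTopCoe with
  | top => exact ⟨0, AddValuation.map_zero _⟩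
  | coe m =>
    refine ⟨algebraMap R (FractionRing R) x ^ m, ?_⟩
    change HahnSeries.addVal ℤ L (IsFractionRing.lift (injective_ofPowerSeries_comp hΦ) _) = _
    rw [map_zpow₀, IsFractionRing.lift_algebraMap, HahnSeries.addVal_apply, RingHom.comp_apply, hx,
      HahnSeries.ofPowerSeries_X, ← RatFunc.single_zpow, HahnSeries.orderTop_single one_ne_zero]

variable {k : Type*} [Field k] [Algebra k L] [IsLocalRing R] {ρ : R →+* k}

/-- If the constant coefficients of the series `Φ r` are the values of a surjection `ρ` onto a
subfield, then `ρ` is the residue map of `R`, so a nonunit is exactly an element of positive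
order. -/
theorem seriesValuation_dominates (hρ : Function.Surjective ρ)
    (hΦρ : ∀ r, constantCoeff (Φ r) = algebraMap k L (ρ r)) :
    Dominates R (seriesValuation Φ hΦ) where
  nonneg r := by
    have := (le_seriesValuation_algebraMap_iff hΦ 0 r).mpr (by simp)
    simpa using this
  mem_maximalIdeal_iff r := by
    have hker : RingHom.ker ρ = IsLocalRing.maximalIdeal R :=
      IsLocalRing.eq_maximalIdeal (RingHom.ker_isMaximal_of_surjective ρ hρ)
    have h1 : (0 : WithTop ℤ) < seriesValuation Φ hΦ (algebraMap R (FractionRing R) r) ↔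
        (((1 : ℕ) : ℤ) : WithTop ℤ) ≤ seriesValuation Φ hΦ (algebraMap R (FractionRing R) r) := by
      generalize seriesValuation Φ hΦ (algebraMap R (FractionRing R) r) = w
      induction w using WithTop.recTopCoe with
      | top => simp
      | coe w =>
        norm_cast
    rw [h1, le_seriesValuation_algebraMap_iff, pow_one, X_dvd_iff, hΦρ, _root_.map_eq_zero, ← hker,
      RingHom.mem_ker]

/-- Taking the coefficient of order `n` identifies `I_n / I_{n+1}` with the space of initial
coefficients of order `n`, as `R`-modules through the residue map. -/
theorem length_valuationIdeal_quotient_succ (hρ : Function.Surjective ρ)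
    (hΦρ : ∀ r, constantCoeff (Φ r) = algebraMap k L (ρ r))
    (hν : Dominates R (seriesValuation Φ hΦ)) (n : ℕ)
    [Module.Finite k (initialCoeffSpace Φ hρ hΦρ n)] :
    Module.length R (valuationIdeal (seriesValuation Φ hΦ) hν n ⧸
      (valuationIdeal (seriesValuation Φ hΦ) hν (n + 1)).submoduleOf
        (valuationIdeal (seriesValuation Φ hΦ) hν n)) =
      (Module.finrank k (initialCoeffSpace Φ hρ hΦρ n) : ℕ∞) := by
  let _ : Algebra R k := ρ.toAlgebra
  let _ : Module R L := Module.compHom L ρ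
  have : IsScalarTower R k L := ⟨fun r a c => by
    change (ρ r * a) • c = ρ r • a • c
    rw [mul_smul]⟩
  have hmem : ∀ m (r : R), r ∈ valuationIdeal (seriesValuation Φ hΦ) hν m ↔ X ^ m ∣ Φ r :=
    fun m r => le_seriesValuation_algebraMap_iff hΦ m r
  let g : valuationIdeal (seriesValuation Φ hΦ) hν n →ₗ[R] initialCoeffSpace Φ hρ hΦρ n :=
    { toFun := fun r => ⟨coeff n (Φ r), r, (hmem n r).mp r.2, rfl⟩
      map_add' := fun r s => Subtype.ext (by simp)
      map_smul' := fun b r => Subtype.ext (by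
        obtain ⟨g, hg⟩ := (hmem n r).mp r.2
        change coeff n (Φ (b * r)) = ρ b • coeff n (Φ r)
        rw [map_mul, hg, mul_left_comm, coeff_X_pow_mul', coeff_X_pow_mul']
        simp [hΦρ, Algebra.smul_def]) }
  have hg : Function.Surjective g := by
    rintro ⟨_, r, hr, rfl⟩
    exact ⟨⟨r, (hmem n r).mpr hr⟩, rfl⟩
  have hker : (valuationIdeal (seriesValuation Φ hΦ) hν (n + 1)).submoduleOf
      (valuationIdeal (seriesValuation Φ hΦ) hν n) = LinearMap.ker g := by
    ext r
    have hr := X_pow_dvd_iff.mp ((hmem n r).mp r.2)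
    rw [LinearMap.mem_ker, Submodule.submoduleOf, Submodule.mem_comap, Submodule.subtype_apply,
      hmem, X_pow_dvd_iff, Subtype.ext_iff]
    constructor
    · exact fun h => h n n.lt_succ_self
    · intro h m hm
      rcases (Nat.lt_succ_iff.mp hm).lt_or_eq with hlt | rfl
      · exact hr m hlt
      · exact h
  rw [((Submodule.quotEquivOfEq _ _ hker).trans (g.quotKerEquivOfSurjective hg)).length_eq,
    Module.length_eq_of_surjective (R := k) hρ, Module.length_eq_finrank]

theorem length_quotient_valuationIdeal (hρ : Function.Surjective ρ)
    (hΦρ : ∀ r, constantCoeff (Φ r) = algebraMap k L (ρ r))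
    (hν : Dominates R (seriesValuation Φ hΦ))
    [∀ n, Module.Finite k (initialCoeffSpace Φ hρ hΦρ n)] (n : ℕ) :
    Module.length R (R ⧸ valuationIdeal (seriesValuation Φ hΦ) hν n) =
      ((∑ m ∈ Finset.range n, Module.finrank k (initialCoeffSpace Φ hρ hΦρ m) : ℕ) : ℕ∞) := by
  induction n with
  | zero =>
    have htop : valuationIdeal (seriesValuation Φ hΦ) hν 0 = ⊤ :=
      eq_top_iff.mpr fun r _ => (le_seriesValuation_algebraMap_iff hΦ 0 r).mpr (by simp)
    rw [Finset.sum_range_zero, Nat.cast_zero, Module.length_eq_zero_iff, htop]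
    infer_instance
  | succ n ih =>
    have hle : valuationIdeal (seriesValuation Φ hΦ) hν (n + 1) ≤
        valuationIdeal (seriesValuation Φ hΦ) hν n := fun r hr =>
      (le_seriesValuation_algebraMap_iff hΦ n r).mpr
        ((pow_dvd_pow X n.le_succ).trans ((le_seriesValuation_algebraMap_iff hΦ (n + 1) r).mp hr))
    rw [length_quotient_eq_add_of_le hle, ih,
      length_valuationIdeal_quotient_succ hΦ hρ hΦρ hν n, Finset.sum_range_succ, add_comm,
      Nat.cast_add]

end SeriesValuation

/-! ### Lacunary series over a residue field extension -/

section LacunarySeries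

open PowerSeries

variable {k L : Type*} [Field k] [Field L] [Algebra k L]

theorem constantCoeff_algebraMap_polynomial (q : Polynomial k) :
    constantCoeff (algebraMap (Polynomial k) L⟦X⟧ q) = algebraMap k L (q.coeff 0) := by
  rw [algebraMap_apply', ← coeff_zero_eq_constantCoeff_apply, coeff_map, Polynomial.coeff_coe]

/-- Series whose initial coefficients are linearly independent over `k` are linearly independent
over `k[X]`: in a relation, the terms of lowest order cannot cancel. -/
theorem linearIndependent_of_constantCoeff {ι : Type*} {g w : ι → L⟦X⟧} (o : ι → ℕ)
    (hg : ∀ i, g i = X ^ o i * w i) (hw : LinearIndependent k fun i => constantCoeff (w i)) :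
    LinearIndependent (Polynomial k) g := by
  classical
  rw [linearIndependent_iff']
  intro s a hsum i₀ hi₀
  by_contra ha
  let b : ι → Polynomial k := fun i => a i * Polynomial.X ^ o i
  have hex : ∃ m, ∃ i ∈ s, (b i).coeff m ≠ 0 := by
    have hb : b i₀ ≠ 0 := mul_ne_zero ha (pow_ne_zero _ Polynomial.X_ne_zero)
    obtain ⟨m, hm⟩ := not_forall.mp (mt Polynomial.ext hb)
    exact ⟨m, i₀, hi₀, by simpa using hm⟩
  obtain ⟨i₁, hi₁, hne⟩ := Nat.find_spec hex
  set m := Nat.find hex with hm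
  -- `m` is the lowest order at which some term of the relation has a nonzero coefficient.
  have hdvd : ∀ i ∈ s, Polynomial.X ^ m ∣ b i := fun i hi =>
    Polynomial.X_pow_dvd_iff.mpr fun d hd => by
      by_contra h
      exact Nat.find_min hex hd ⟨i, hi, h⟩
  have hcoeff : ∀ i ∈ s, coeff m (a i • g i) = (b i).coeff m • constantCoeff (w i) := by
    intro i hi
    obtain ⟨h, hh⟩ := hdvd i hi
    have hX : algebraMap (Polynomial k) L⟦X⟧ Polynomial.X = X := by
      rw [algebraMap_apply', Polynomial.coe_X, map_X]
    have : a i • g i = X ^ m * (algebraMap (Polynomial k) L⟦X⟧ h * w i) := by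
      rw [hg, Algebra.smul_def, ← mul_assoc, ← hX, ← map_pow, ← map_pow, ← map_mul, ← mul_assoc,
        ← map_mul, ← hh]
    rw [this, hh, coeff_X_pow_mul', if_pos le_rfl, Nat.sub_self, coeff_zero_eq_constantCoeff_apply,
      map_mul, constantCoeff_algebraMap_polynomial, Polynomial.coeff_X_pow_mul', if_pos le_rfl,
      Nat.sub_self, Algebra.smul_def]
  have hzero := congrArg (coeff m) hsum
  rw [map_sum, map_zero, Finset.sum_congr rfl hcoeff] at hzero
  exact hne (linearIndependent_iff'.mp hw s _ hzero i₁ hi₁)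

/-- If infinitely many polynomials in `y` over `k[X]` have linearly independent initial
coefficients, then `y` is transcendental: otherwise they would be infinitely many linearly
independent elements of a finite extension of `k(X)`. -/
theorem transcendental_of_infinite_residue {y : L⟦X⟧} {w : ℕ → L⟦X⟧} (N o : ℕ → ℕ)
    (q : ℕ → Polynomial k)
    (hy : ∀ j, y ^ N j - algebraMap (Polynomial k) L⟦X⟧ (q j) = X ^ o j * w j)
    (hw : LinearIndependent k fun j => constantCoeff (w j)) :
    Transcendental (Polynomial k) y := by
  intro halg
  let F := FractionRing (Polynomial k)
  let M := FractionRing L⟦X⟧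
  have hinj : Function.Injective (algebraMap (Polynomial k) L⟦X⟧) := by
    intro p p' h
    rw [algebraMap_apply', algebraMap_apply'] at h
    exact Polynomial.coe_injective _ (map_injective _ (algebraMap k L).injective h)
  have : FaithfulSMul (Polynomial k) L⟦X⟧ := (faithfulSMul_iff_algebraMap_injective _ _).mpr hinj
  have : FaithfulSMul (Polynomial k) M := FaithfulSMul.trans _ L⟦X⟧ _
  let _ : Algebra F M := FractionRing.liftAlgebra (Polynomial k) M
  have : IsScalarTower (Polynomial k) F M := FractionRing.isScalarTower_liftAlgebra _ _
  have hM : IsAlgebraic (Polynomial k) (algebraMap L⟦X⟧ M y) := halg.algebraMap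
  have hint : IsIntegral F (algebraMap L⟦X⟧ M y) :=
    (hM.extendScalars
      (IsFractionRing.injective (Polynomial k) F)).isIntegral
  have : FiniteDimensional F (IntermediateField.adjoin F {algebraMap L⟦X⟧ M y}) :=
    IntermediateField.adjoin.finiteDimensional hint
  have hli : LinearIndependent F fun j => algebraMap L⟦X⟧ M
      (y ^ N j - algebraMap (Polynomial k) L⟦X⟧ (q j)) := by
    rw [← LinearIndependent.iff_fractionRing (Polynomial k) F]
    exact (linearIndependent_of_constantCoeff o hy hw).map'
      (IsScalarTower.toAlgHom (Polynomial k) L⟦X⟧ M).toLinearMap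
      (LinearMap.ker_eq_bot.mpr (IsFractionRing.injective L⟦X⟧ M))
  have hmem : ∀ j, algebraMap L⟦X⟧ M (y ^ N j - algebraMap (Polynomial k) L⟦X⟧ (q j)) ∈
      IntermediateField.adjoin F {algebraMap L⟦X⟧ M y} := by
    intro j
    rw [map_sub, map_pow, ← IsScalarTower.algebraMap_apply (Polynomial k) L⟦X⟧ M,
      IsScalarTower.algebraMap_apply (Polynomial k) F M]
    exact sub_mem (pow_mem (IntermediateField.mem_adjoin_simple_self _ _) _)
      (IntermediateField.algebraMap_mem _ _)
  have hli' : LinearIndependent F fun j =>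
      (⟨_, hmem j⟩ : IntermediateField.adjoin F {algebraMap L⟦X⟧ M y}) :=
    LinearIndependent.of_comp (IntermediateField.val _).toLinearMap hli
  have := hli'.finite
  exact not_finite ℕ

/-- The series `∑ i, c i * X ^ e i`, for an injective sequence of exponents `e`. -/
noncomputable def lacunarySeries (c : ℕ → L) (e : ℕ → ℕ) : L⟦X⟧ :=
  PowerSeries.mk (Function.extend e c 0)

theorem coeff_lacunarySeries_of_lt {c : ℕ → L} {e : ℕ → ℕ} (he : StrictMono e) {m j : ℕ}
    (hm : m < e j) : coeff m (lacunarySeries c e) = 0 ∨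
      ∃ i < j, coeff m (lacunarySeries c e) = c i := by
  rw [lacunarySeries, coeff_mk]
  by_cases h : ∃ i, e i = m
  · obtain ⟨i, rfl⟩ := h
    exact Or.inr ⟨i, he.lt_iff_lt.mp hm, he.injective.extend_apply c 0 i⟩
  · exact Or.inl (Function.extend_apply' _ _ _ h)

/-- By additivity of Frobenius, raising `∑ i, c i * X ^ e i` to the power `2 ^ j` moves the first
`j` terms into `k[X]`. Subtracting them leaves a series with initial coefficient
`c j ^ 2 ^ j`. -/
theorem exists_lacunarySeries_pow_sub [CharP L 2] {c : ℕ → L} {e : ℕ → ℕ} (he : StrictMono e)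
    (hc : ∀ i j, i < j → c i ^ 2 ^ j ∈ (algebraMap k L).range) (j : ℕ) :
    ∃ (q : Polynomial k) (w : L⟦X⟧),
      lacunarySeries c e ^ 2 ^ j - algebraMap (Polynomial k) L⟦X⟧ q = X ^ (2 ^ j * e j) * w ∧
      constantCoeff w = c j ^ 2 ^ j := by
  have : CharP L⟦X⟧ 2 := charP_of_injective_ringHom (f := C (R := L)) C_injective 2
  set y := lacunarySeries c e with hy
  let u : L⟦X⟧ := PowerSeries.mk fun i => coeff (i + e j) y
  have hdecomp : y = X ^ e j * u + (trunc (e j) y : L⟦X⟧) := eq_X_pow_mul_shift_add_trunc (e j) y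
  have htrunc : (trunc (e j) y : L⟦X⟧) ^ 2 ^ j ∈ (algebraMap (Polynomial k) L⟦X⟧).range := by
    have hsum : (trunc (e j) y : L⟦X⟧) = ∑ m ∈ Finset.Ico 0 (e j), C (coeff m y) * X ^ m := by
      ext d
      simp only [Polynomial.coeff_coe, coeff_trunc, map_sum, coeff_C_mul, coeff_X_pow, mul_ite,
        mul_one, mul_zero, Finset.sum_ite_eq, Finset.mem_Ico, zero_le, true_and]
    rw [hsum, sum_pow_char_pow]
    refine sum_mem fun m hm => ?_
    have hmem : coeff m y ^ 2 ^ j ∈ (algebraMap k L).range := by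
      rcases coeff_lacunarySeries_of_lt (c := c) he (Finset.mem_Ico.mp hm).2 with h | ⟨i, hi, h⟩
      · rw [hy, h, zero_pow (by positivity)]
        exact zero_mem _
      · rw [hy, h]
        exact hc i j hi
    obtain ⟨z, hz⟩ := hmem
    rw [mul_pow, ← map_pow, ← hz, ← pow_mul]
    refine ⟨Polynomial.C z * Polynomial.X ^ (m * 2 ^ j), ?_⟩
    rw [algebraMap_apply']
    simp
  obtain ⟨q, hq⟩ := htrunc
  refine ⟨q, u ^ 2 ^ j, ?_, ?_⟩
  · rw [hq]
    nth_rw 1 [hdecomp]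
    rw [add_pow_char_pow, add_sub_cancel_right, mul_pow, ← pow_mul, mul_comm (e j)]
  · rw [map_pow, ← coeff_zero_eq_constantCoeff_apply, coeff_mk, zero_add, hy, lacunarySeries,
      coeff_mk, he.injective.extend_apply]

/-- The series whose coefficients up to order `n` lie in the subfield `E`. -/
def coeffSubring (E : Subfield L) (n : ℕ) : Subring L⟦X⟧ where
  carrier := {f | ∀ m ≤ n, coeff m f ∈ E}
  zero_mem' m _ := by simp
  one_mem' m _ := by
    rw [coeff_one]
    split_ifs
    exacts [one_mem E, zero_mem E]
  add_mem' hf hg m hm := by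
    rw [map_add]
    exact add_mem (hf m hm) (hg m hm)
  neg_mem' hf m hm := by
    rw [map_neg]
    exact neg_mem (hf m hm)
  mul_mem' hf hg m hm := by
    rw [coeff_mul]
    exact sum_mem fun x hx => mul_mem
      (hf _ ((Finset.HasAntidiagonal.antidiagonal.fst_le hx).trans hm))
      (hg _ ((Finset.HasAntidiagonal.antidiagonal.snd_le hx).trans hm))

/-- Below the exponent `e j`, only `c i` with `i < j` enter the coefficients of a polynomial in the
lacunary series. -/
theorem aeval_lacunarySeries_mem_coeffSubring {c : ℕ → L} {e : ℕ → ℕ} (he : StrictMono e)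
    (E : IntermediateField k L) {n j : ℕ} (hn : n < e j) (hc : ∀ i < j, c i ∈ E)
    (r : Polynomial (Polynomial k)) :
    Polynomial.aeval (lacunarySeries c e) r ∈ coeffSubring E.toSubfield n := by
  rw [Polynomial.aeval_eq_sum_range]
  refine sum_mem fun i _ => ?_
  rw [Algebra.smul_def]
  refine mul_mem (fun m _ => ?_) (pow_mem (fun m hm => ?_) _)
  · rw [algebraMap_apply', coeff_map]
    exact E.algebraMap_mem _
  · rcases coeff_lacunarySeries_of_lt (c := c) he (hm.trans_lt hn) with h | ⟨i, hi, h⟩ <;> rw [h]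
    exacts [zero_mem _, hc i hi]

end LacunarySeries

/-! ### The local ring of the plane at the origin -/

section LocalRingAtOrigin

open Polynomial

/-- Evaluation at the origin of the affine plane, on `k[X][Y]`. -/
noncomputable def evalOrigin (k : Type*) [Field k] : k[X][X] →+* k :=
  (constantCoeff : k[X] →+* k).comp (constantCoeff : k[X][X] →+* k[X])

/-- The maximal ideal of the origin in `k[X][Y]`. -/
noncomputable def originIdeal (k : Type*) [Field k] : Ideal k[X][X] :=
  RingHom.ker (evalOrigin k)

instance originIdeal_isPrime (k : Type*) [Field k] : (originIdeal k).IsPrime :=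
  RingHom.ker_isPrime _

/-- The local ring of the affine plane over `k` at the origin. -/
abbrev PlaneLocalRing (k : Type*) [Field k] : Type _ :=
  Localization.AtPrime (originIdeal k)

variable (k : Type*) [Field k]

theorem mem_originIdeal_primeCompl_iff (r : k[X][X]) :
    r ∈ (originIdeal k).primeCompl ↔ evalOrigin k r ≠ 0 :=
  Iff.rfl

theorem ringKrullDim_planeLocalRing : ringKrullDim (PlaneLocalRing k) = 2 := by
  rw [IsLocalization.AtPrime.ringKrullDim_eq_height (originIdeal k) (PlaneLocalRing k)]
  refine le_antisymm ?_ ?_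
  · calc ((originIdeal k).height : WithBot ℕ∞) ≤ ringKrullDim k[X][X] :=
          Ideal.height_le_ringKrullDim_of_ne_top Ideal.IsPrime.ne_top'
      _ = 2 := by
        rw [ringKrullDim_of_isNoetherianRing, ringKrullDim_of_isNoetherianRing,
          ringKrullDim_eq_zero_of_field]
        norm_num
  -- The lower bound comes from the chain of primes `0 < (Y) < (X, Y)`.
  · let I : Ideal k[X][X] := RingHom.ker (constantCoeff : k[X][X] →+* k[X])
    have hI : I.IsPrime := RingHom.ker_isPrime _
    have h0 : (⊥ : Ideal k[X][X]) < I := by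
      refine bot_lt_iff_ne_bot.mpr fun h => ?_
      have : (X : k[X][X]) ∈ I := by simp [I]
      rw [h] at this
      exact X_ne_zero (Ideal.mem_bot.mp this)
    have h1 : I < originIdeal k := by
      refine lt_of_le_of_ne (fun r hr => ?_) fun h => ?_
      · have hr : constantCoeff r = 0 := hr
        change constantCoeff (constantCoeff r) = 0
        rw [hr, map_zero]
      · have : (C X : k[X][X]) ∈ originIdeal k := by
          change constantCoeff (constantCoeff (C X)) = (0 : k)
          simp
        rw [← h] at this
        have hX : constantCoeff (C X : k[X][X]) = 0 := this
        simp at hX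
    have h2 := Ideal.height_add_one_le_of_lt_of_isPrime h0
    have h3 := Ideal.height_add_one_le_of_lt_of_isPrime h1
    have h4 : (2 : ℕ∞) ≤ (originIdeal k).height := by
      refine le_trans ?_ h3
      calc (2 : ℕ∞) = 0 + 1 + 1 := by norm_num
        _ ≤ I.height + 1 := by
          gcongr
          exact le_trans (by gcongr; exact zero_le) h2
    exact WithBot.coe_le_coe.mpr h4

/-- The residue map of the local ring at the origin. -/
noncomputable def planeResidue : PlaneLocalRing k →+* k :=
  IsLocalization.lift (M := (originIdeal k).primeCompl) (g := evalOrigin k) fun s =>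
    isUnit_iff_ne_zero.mpr ((mem_originIdeal_primeCompl_iff k s).mp s.2)

theorem planeResidue_algebraMap (r : k[X][X]) :
    planeResidue k (algebraMap _ _ r) = evalOrigin k r :=
  IsLocalization.lift_eq _ _

theorem planeResidue_surjective : Function.Surjective (planeResidue k) := fun a =>
  ⟨algebraMap k[X][X] _ (C (C a)), by rw [planeResidue_algebraMap]; simp [evalOrigin]⟩

variable {k} {L : Type*} [Field L] [Algebra k L] {y : PowerSeries L}

theorem constantCoeff_aeval (hy : PowerSeries.constantCoeff y = 0) (r : k[X][X]) :
    PowerSeries.constantCoeff (aeval y r) = algebraMap k L (evalOrigin k r) := by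
  rw [aeval_def, hom_eval₂, hy, eval₂_at_zero]
  exact constantCoeff_algebraMap_polynomial _

/-- For a series `y` without constant term, the map from the local ring of the plane at the origin
to `L⟦X⟧` that restricts a function to the formal branch `t ↦ (t, y t)`. -/
noncomputable def branchMap (y : PowerSeries L) (hy : PowerSeries.constantCoeff y = 0) :
    PlaneLocalRing k →+* PowerSeries L :=
  IsLocalization.lift (M := (originIdeal k).primeCompl) (g := (aeval (R := k[X]) y).toRingHom)
    fun s => by
      rw [PowerSeries.isUnit_iff_constantCoeff, isUnit_iff_ne_zero]
      change PowerSeries.constantCoeff (aeval y (s : k[X][X])) ≠ 0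
      rw [constantCoeff_aeval hy]
      exact (_root_.map_ne_zero _).mpr ((mem_originIdeal_primeCompl_iff k s).mp s.2)

variable (hy : PowerSeries.constantCoeff y = 0)

theorem branchMap_algebraMap (r : k[X][X]) :
    branchMap y hy (algebraMap _ (PlaneLocalRing k) r) = aeval y r :=
  IsLocalization.lift_eq _ _

theorem branchMap_injective (htr : Transcendental k[X] y) :
    Function.Injective (branchMap (k := k) y hy) := by
  rw [injective_iff_map_eq_zero]
  intro r hr
  obtain ⟨a, s, rfl⟩ := IsLocalization.exists_mk'_eq (originIdeal k).primeCompl r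
  have h := congrArg (branchMap y hy) (IsLocalization.mk'_spec (PlaneLocalRing k) a s)
  rw [map_mul, hr, zero_mul, branchMap_algebraMap] at h
  have ha : a = 0 := transcendental_iff_injective.mp htr (by rw [← h, map_zero])
  rw [ha, IsLocalization.mk'_zero]

theorem constantCoeff_branchMap (r : PlaneLocalRing k) :
    PowerSeries.constantCoeff (branchMap y hy r) = algebraMap k L (planeResidue k r) := by
  have : (PowerSeries.constantCoeff.comp (branchMap (k := k) y hy)) =
      (algebraMap k L).comp (planeResidue k) := by
    refine IsLocalization.ringHom_ext (originIdeal k).primeCompl (RingHom.ext fun a => ?_)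
    simp only [RingHom.comp_apply]
    rw [branchMap_algebraMap, planeResidue_algebraMap, constantCoeff_aeval hy]
  exact RingHom.congr_fun this r

theorem branchMap_X :
    branchMap y hy (algebraMap k[X][X] (PlaneLocalRing k) (C X)) = PowerSeries.X := by
  rw [branchMap_algebraMap, aeval_C, PowerSeries.algebraMap_apply', Polynomial.coe_X,
    PowerSeries.map_X]

end LocalRingAtOrigin

section InitialCoefficients

open PowerSeries

variable {k L : Type*} [Field k] [Field L] [Algebra k L] {y : L⟦X⟧} (hy : constantCoeff y = 0)

/-- The space of initial coefficients of order `n` along the formal branch of `y`. -/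
noncomputable abbrev branchSpace (k : Type*) {L : Type*} [Field k] [Field L] [Algebra k L]
    {y : L⟦X⟧} (hy : constantCoeff y = 0) (n : ℕ) : Submodule k L :=
  initialCoeffSpace (branchMap (k := k) y hy) (planeResidue_surjective k)
    (fun r => constantCoeff_branchMap hy r) n

/-- The initial coefficient of a fraction `a / s` with `s` a unit is that of `a` divided by the
value of `s` at the origin, which lies in `k`; so it suffices to control polynomials. -/
theorem initialCoeffSpace_branchMap_le (E : IntermediateField k L) {n : ℕ}
    (hE : ∀ r : Polynomial (Polynomial k), Polynomial.aeval y r ∈ coeffSubring E.toSubfield n) :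
    branchSpace k hy n ≤ Subalgebra.toSubmodule E.toSubalgebra := by
  rintro _ ⟨r, hr, rfl⟩
  obtain ⟨a, s, rfl⟩ := IsLocalization.exists_mk'_eq (originIdeal k).primeCompl r
  have h := congrArg (branchMap y hy) (IsLocalization.mk'_spec (PlaneLocalRing k) a s)
  obtain ⟨g, hg⟩ := hr
  have hs : evalOrigin k s ≠ 0 := (mem_originIdeal_primeCompl_iff k s).mp s.2
  rw [map_mul, branchMap_algebraMap, branchMap_algebraMap, hg, mul_assoc] at h
  have hcoeff := congrArg (coeff n) h
  rw [coeff_X_pow_mul', if_pos le_rfl, Nat.sub_self, coeff_zero_eq_constantCoeff_apply, map_mul,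
    constantCoeff_aeval hy] at hcoeff
  rw [hg, coeff_X_pow_mul', if_pos le_rfl, Nat.sub_self, coeff_zero_eq_constantCoeff_apply,
    eq_div_of_mul_eq ((_root_.map_ne_zero _).mpr hs) hcoeff]
  exact E.div_mem (hE a n le_rfl) (E.algebraMap_mem _)

/-- Multiplication by powers of the first coordinate, which has order one along the branch, turns an
initial coefficient of order `o` into one of every order `n ≥ o`. -/
theorem mem_initialCoeffSpace_branchMap {q : Polynomial k} {w : L⟦X⟧} {N o n : ℕ}
    (h : y ^ N - algebraMap (Polynomial k) L⟦X⟧ q = X ^ o * w) (hn : o ≤ n) :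
    constantCoeff w ∈ branchSpace k hy n := by
  refine ⟨algebraMap (Polynomial (Polynomial k)) _ (Polynomial.C Polynomial.X ^ (n - o) *
    (Polynomial.X ^ N - Polynomial.C q)), ?_⟩
  have : branchMap y hy (algebraMap (Polynomial (Polynomial k)) (PlaneLocalRing k)
      (Polynomial.C Polynomial.X ^ (n - o) *
      (Polynomial.X ^ N - Polynomial.C q))) = X ^ n * w := by
    rw [map_mul, map_pow, map_mul, map_pow, branchMap_X, branchMap_algebraMap, map_sub, map_pow,
      Polynomial.aeval_X, Polynomial.aeval_C, h, ← mul_assoc, ← pow_add, Nat.sub_add_cancel hn]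
  rw [this]
  refine ⟨dvd_mul_right _ _, ?_⟩
  rw [coeff_X_pow_mul', if_pos le_rfl, Nat.sub_self, coeff_zero_eq_constantCoeff_apply]

end InitialCoefficients

/-! ### Growth of the lengths along a lacunary branch -/

section BranchGrowth

open PowerSeries Filter Asymptotics

theorem exists_strictMono_ge (b : ℕ → ℕ) :
    ∃ e : ℕ → ℕ, StrictMono e ∧ 0 < e 0 ∧ ∀ j, b j ≤ e j := by
  refine ⟨fun j => ∑ i ∈ Finset.range (j + 1), (b i + 1), strictMono_nat_of_lt_succ fun j => ?_,
    by simp, fun j => ?_⟩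
  · rw [Finset.sum_range_succ _ (j + 1)]
    omega
  · beta_reduce
    rw [Finset.sum_range_succ]
    omega

/-- The square roots of the variables are linearly independent over the rational function field in
characteristic `2`: squaring a relation gives `∑ a i ^ 2 * X i = 0`, and the derivative with respect
to `X j`, which kills squares, returns `a j ^ 2 = 0`. -/
theorem linearIndependent_of_sq_eq_X {σ L : Type*} [Field L]
    [Algebra (FractionRing (MvPolynomial σ (ZMod 2))) L] {b : σ → L}
    (hb : ∀ i, b i ^ 2 = algebraMap (FractionRing (MvPolynomial σ (ZMod 2))) L
      (algebraMap (MvPolynomial σ (ZMod 2)) _ (MvPolynomial.X i))) :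
    LinearIndependent (FractionRing (MvPolynomial σ (ZMod 2))) b := by
  classical
  let A := MvPolynomial σ (ZMod 2)
  let k := FractionRing A
  let _ : Algebra A L := ((algebraMap k L).comp (algebraMap A k)).toAlgebra
  have : IsScalarTower A k L := IsScalarTower.of_algebraMap_eq fun _ => rfl
  have hinj : Function.Injective (algebraMap A L) :=
    (algebraMap k L).injective.comp (IsFractionRing.injective A k)
  have : CharP L 2 := charP_of_injective_ringHom hinj 2
  rw [← LinearIndependent.iff_fractionRing A k, linearIndependent_iff']
  intro s a hsum j hj
  have hsq : ∑ i ∈ s, a i ^ 2 * MvPolynomial.X i = 0 := by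
    refine hinj ?_
    have := congrArg (· ^ 2) hsum
    simp only [sum_pow_char, Algebra.smul_def, mul_pow, hb] at this
    rw [map_sum, map_zero, ← zero_pow (two_ne_zero : (2 : ℕ) ≠ 0), ← this]
    refine Finset.sum_congr rfl fun i _ => ?_
    rw [map_mul, map_pow]
    rfl
  have hder := congrArg (MvPolynomial.pderiv j) hsq
  rw [map_sum, map_zero, Finset.sum_eq_single j] at hder
  · simpa [Derivation.leibniz, Derivation.leibniz_pow, CharTwo.two_eq_zero] using hder
  · intro i _ hij
    simp [Derivation.leibniz, Derivation.leibniz_pow, MvPolynomial.pderiv_X_of_ne hij,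
      CharTwo.two_eq_zero]
  · exact fun h => absurd hj h

variable {k L : Type*} [Field k] [Field L] [Algebra k L]

theorem constantCoeff_lacunarySeries (c : ℕ → L) {e : ℕ → ℕ} (he : StrictMono e)
    (he0 : 0 < e 0) : constantCoeff (lacunarySeries c e) = 0 := by
  rw [← coeff_zero_eq_constantCoeff_apply]
  rcases coeff_lacunarySeries_of_lt (c := c) he he0 with h | ⟨i, hi, -⟩
  · exact h
  · exact absurd hi (Nat.not_lt_zero i)

/-- When the exponents grow quickly compared with the degrees of the fields `E j` generated by the
coefficients, the spaces of initial coefficients have dimension `o(n)`: those of order below `e j`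
lie in `E j`. -/
theorem finrank_branchSpace_isLittleO {c : ℕ → L} {e : ℕ → ℕ} (he : StrictMono e)
    (E : ℕ → IntermediateField k L) [∀ j, FiniteDimensional k (E j)]
    (hcE : ∀ j, ∀ i < j, c i ∈ E j) (heE : ∀ j, (j + 1) * Module.finrank k (E (j + 1)) ≤ e j)
    (hy : constantCoeff (lacunarySeries c e) = 0) :
    (∀ n, Module.Finite k (branchSpace k hy n)) ∧
      (fun n => (Module.finrank k (branchSpace k hy n) : ℝ)) =o[atTop] fun n : ℕ => (n : ℝ) := by
  have hle : ∀ n j, n < e j →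
      branchSpace k hy n ≤ Subalgebra.toSubmodule (E j).toSubalgebra := fun n j hn =>
    initialCoeffSpace_branchMap_le hy (E j)
      (aeval_lacunarySeries_mem_coeffSubring he (E j) hn (hcE j))
  have hfin : ∀ j, Module.Finite k (Subalgebra.toSubmodule (E j).toSubalgebra) := fun j =>
    inferInstanceAs (FiniteDimensional k (E j))
  refine ⟨fun n => Submodule.finiteDimensional_of_le
    (hle n (n + 1) (n.lt_succ_self.trans_le (he.le_apply))), ?_⟩
  rw [isLittleO_iff_nat_mul_le]
  intro N
  filter_upwards [eventually_ge_atTop (e N)] with n hn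
  simp only [Real.norm_natCast]
  norm_cast
  have hex : ∃ j, n < e j := ⟨n + 1, n.lt_succ_self.trans_le he.le_apply⟩
  obtain ⟨i, hi⟩ : ∃ i, Nat.find hex = i + 1 := by
    refine Nat.exists_eq_succ_of_ne_zero fun h0 => ?_
    have := Nat.find_spec hex
    rw [h0] at this
    exact absurd (this.trans_le (he.monotone N.zero_le)) hn.not_gt
  have hlt : n < e (i + 1) := hi ▸ Nat.find_spec hex
  have hge : e i ≤ n := not_lt.mp (Nat.find_min hex (hi ▸ i.lt_succ_self))
  have hNi : N < i + 1 := he.lt_iff_lt.mp (hn.trans_lt hlt)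
  calc N * Module.finrank k (branchSpace k hy n)
      ≤ (i + 1) * Module.finrank k (E (i + 1)) :=
        Nat.mul_le_mul hNi.le (Submodule.finrank_mono (hle n (i + 1) hlt))
    _ ≤ e i := heE i
    _ ≤ n := hge

theorem finrank_branchSpace_tendsto_atTop {y : L⟦X⟧} (hy : constantCoeff y = 0)
    [∀ n, Module.Finite k (branchSpace k hy n)] {N o : ℕ → ℕ} (ho : Monotone o)
    {q : ℕ → Polynomial k} {w : ℕ → L⟦X⟧}
    (h : ∀ j, y ^ N j - algebraMap (Polynomial k) L⟦X⟧ (q j) = X ^ o j * w j)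
    (hw : LinearIndependent k fun j => constantCoeff (w j)) :
    Tendsto (fun n => Module.finrank k (branchSpace k hy n)) atTop atTop := by
  refine tendsto_atTop.mpr fun r => ?_
  filter_upwards [eventually_ge_atTop (o r)] with n hn
  have hmem : ∀ j : Fin r, constantCoeff (w j) ∈ branchSpace k hy n := fun j =>
    mem_initialCoeffSpace_branchMap hy (h j) ((ho j.2.le).trans hn)
  have hli : LinearIndependent k fun j : Fin r => (⟨_, hmem j⟩ : branchSpace k hy n) :=
    LinearIndependent.of_comp (branchSpace k hy n).subtype
      (hw.comp (fun j : Fin r => (j : ℕ)) Fin.val_injective)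
  simpa using hli.fintype_card_le_finrank

end BranchGrowth

/-! ### The example -/

theorem theorem1p3 :
    ∃ (R : Type) (_ : CommRing R) (_ : IsDomain R) (_ : IsRegularLocalRing R)
      (ν : AddValuation (FractionRing R) (WithTop ℤ)) (hν : Dominates R ν),
      ringKrullDim R = 2 ∧
      IsNormalizedDiscrete ν ∧
      -- `α n` is the length of `I_n / I_{n+1}`
      (∃ α : ℕ → ℕ,
        (∀ n, Module.length R
          (valuationIdeal ν hν n ⧸
            (valuationIdeal ν hν (n + 1)).submoduleOf (valuationIdeal ν hν n)) = (α n : ℕ∞)) ∧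
        ¬ IsEventuallyQuasiPolynomialPlusBounded (fun n => (α n : ℝ))) ∧
      -- `H n` is the length of `R / I_n`
      (∃ H : ℕ → ℕ,
        (∀ n, Module.length R (R ⧸ valuationIdeal ν hν n) = (H n : ℕ∞)) ∧
        ¬ IsEventuallyQuasiPolynomialPlusBounded (fun n => (H n : ℝ))) := by
  let A := MvPolynomial ℕ (ZMod 2)
  let k := FractionRing A
  let L := AlgebraicClosure k
  have : CharP k 2 := charP_of_injective_ringHom (IsFractionRing.injective A k) 2
  have : CharP L 2 := charP_of_injective_ringHom (algebraMap k L).injective 2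
  -- `c i` is the `2 ^ (i + 1)`-th root of the `i`-th variable, so `c i ^ 2 ^ i` is its square root.
  choose c hc using fun i : ℕ => IsAlgClosed.exists_pow_nat_eq
    (algebraMap k L (algebraMap A k (MvPolynomial.X i))) (show 0 < 2 ^ (i + 1) by positivity)
  let E : ℕ → IntermediateField k L := fun j => IntermediateField.adjoin k (c '' Set.Iio j)
  have hE : ∀ j, FiniteDimensional k (E j) := fun j =>
    have : Finite (c '' Set.Iio j) := ((Set.finite_Iio j).image c).to_subtype
    IntermediateField.finiteDimensional_adjoin fun x _ =>
      (AlgebraicClosure.isAlgebraic k).isAlgebraic x |>.isIntegral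
  have hcE : ∀ j, ∀ i < j, c i ∈ E j := fun j i hij =>
    IntermediateField.subset_adjoin k _ ⟨i, hij, rfl⟩
  obtain ⟨e, he, he0, heE⟩ := exists_strictMono_ge fun j => (j + 1) * Module.finrank k (E (j + 1))
  have hcroot : ∀ i j, i < j → c i ^ 2 ^ j ∈ (algebraMap k L).range := by
    intro i j hij
    obtain ⟨r, rfl⟩ := Nat.exists_eq_add_of_le (Nat.succ_le_of_lt hij)
    rw [pow_add 2 (i + 1) r, pow_mul, hc]
    exact pow_mem (RingHom.mem_range_self _ _) _
  choose q w hq hw using exists_lacunarySeries_pow_sub he hcroot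
  have hli : LinearIndependent k fun j => PowerSeries.constantCoeff (w j) := by
    refine linearIndependent_of_sq_eq_X fun j => ?_
    rw [hw, ← pow_mul, ← pow_succ, hc]
  have hy := constantCoeff_lacunarySeries c he he0
  have hinj := branchMap_injective hy
    (transcendental_of_infinite_residue (fun j => 2 ^ j) (fun j => 2 ^ j * e j) q hq hli)
  have hres : ∀ r : PlaneLocalRing k, PowerSeries.constantCoeff (branchMap _ hy r) =
      algebraMap k L (planeResidue k r) := constantCoeff_branchMap hy
  have hν := seriesValuation_dominates (R := PlaneLocalRing k) (k := k) hinj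
    (planeResidue_surjective k) hres
  obtain ⟨hfin, hupp⟩ := finrank_branchSpace_isLittleO he E hcE heE hy
  have hlow : Filter.Tendsto (fun n => Module.finrank k (branchSpace k hy n)) .atTop .atTop :=
    finrank_branchSpace_tendsto_atTop hy (N := fun j => 2 ^ j) (o := fun j => 2 ^ j * e j)
      (fun i j hij => Nat.mul_le_mul (Nat.pow_le_pow_right two_pos hij) (he.monotone hij)) hq hli
  refine ⟨PlaneLocalRing k, inferInstance, inferInstance, inferInstance, seriesValuation _ hinj, hν,
    ringKrullDim_planeLocalRing k, seriesValuation_surjective hinj (branchMap_X hy), ?_, ?_⟩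
  · refine ⟨_, fun n => length_valuationIdeal_quotient_succ hinj (planeResidue_surjective k)
      hres hν n, ?_⟩
    refine not_isEventuallyQuasiPolynomialPlusBounded_of_isLittleO 0 ?_ (by simpa using hupp)
    simp only [pow_zero]
    exact Asymptotics.isLittleO_const_left.mpr
      (Or.inr (tendsto_norm_atTop_atTop.comp (tendsto_natCast_atTop_atTop.comp hlow)))
  · refine ⟨_, fun n => length_quotient_valuationIdeal hinj (planeResidue_surjective k)
      hres hν n, ?_⟩
    refine not_isEventuallyQuasiPolynomialPlusBounded_of_isLittleO 1 ?_
      (sum_range_isLittleO_of_isLittleO hupp)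
    simpa only [pow_one] using isLittleO_sum_range_of_tendsto hlow
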